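/- **Setting.** Rings are unital; modules are unital left modules. A commutative ring $R$ is called pseudo-noetherian if for every $a\in R$ the set of prime ideals minimal among those containing $a$ is finite and $R_{\mathfrak p}$ is noetherian for each such prime $\mathfrak p$. Let $R$ be a reduced pseudo-noetherian ring and let $A$ be a reduced pseudo-noetherian order over $R$, that is, an $R$-algebra without nonzero nilpotent two-sided ideals, torsion free as an $R$-module, such that $A_{\mathfrak p}$ is (left) noetherian for every prime ideal $\mathfrak p$ of $R$ of height at most $1$. Let $\mathcal P$ be the set of prime ideals of $R$ of height $1$, let $\mathcal X$ be the Serre subcategory of $A\text{-}\mathrm{Mod}$ of all modules $X$ with $X_{\mathfrak p}=0$ for all $\mathfrak p\in\mathcal P$, and let $F:A\text{-}\mathrm{Mod}\to A\text{-}\mathrm{Mod}/\mathcal X$ be the quotient functor. Let $Q$ be the full ring of fractions of $R$ and write $QM=Q\otimes_R M$. A module $M$ is torsion if each of its elements is annihilated by a non-zero-divisor of $R$, and torsion free if no nonzero element is; a torsion free $M$ is identified with its image in $QM$, and then we put $$M_{\mathcal P}=\{x\in QM\mid \forall\,\mathfrak p\in\mathcal P\ \exists\, r\in R\setminus\mathfrak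 p:\ rx\in M\}.$$ **Theorem.** The functor $F$ has a right adjoint $G$ (the section functor). For every $A$-module $M$: 1. If $M$ is torsion, then $GFM\simeq\coprod_{\mathfrak p\in\mathcal P}M_{\mathfrak p}$ as $A$-modules. 2. If $M$ is torsion free and every minimal prime ideal of $R$ is contained in some $\mathfrak p\in\mathcal P$, then $GFM\simeq M_{\mathcal P}$ as $A$-modules. -/

import Mathlib

open CategoryTheory
open scoped TensorProduct DirectSum nonZeroDivisors

universe u v w

noncomputable section

/-- A commutative ring is pseudo-noetherian if for every element `a` the set of prime ideals
minimal over `a` is finite and the localization at each of them is noetherian. -/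
structure IsPseudoNoetherianRing (R : Type u) [CommRing R] : Prop where
  finite_minimalPrimes : ∀ a : R, (Ideal.span {a}).minimalPrimes.Finite
  isNoetherianRing_localization : ∀ (a : R) (P : Ideal R) [P.IsPrime],
    P ∈ (Ideal.span {a}).minimalPrimes → IsNoetherianRing (Localization.AtPrime P)

/-- An `R`-algebra `A` is pseudo-noetherian if the ring `A_P` is noetherian for every prime ideal
`P` of `R` of height at most `1`. (`IsNoetherianRing` is the left noetherian condition.) -/
def IsPseudoNoetherianAlgebra (R : Type u) (A : Type v) [CommRing R] [Ring A] [Algebra R A] :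
    Prop :=
  ∀ (P : Ideal R) [P.IsPrime], P.height ≤ 1 → IsNoetherianRing (A ⊗[R] Localization.AtPrime P)

/-- A (not necessarily commutative) ring without nonzero nilpotent two-sided ideals. -/
def HasNoNilpotentIdeals (A : Type v) [Ring A] : Prop :=
  ∀ I : Ideal A, I.IsTwoSided → ∀ n : ℕ, I ^ n = ⊥ → I = ⊥

/-- `A` is a reduced pseudo-noetherian order over the reduced pseudo-noetherian ring `R`. -/
structure IsReducedPseudoNoetherianOrder (R : Type u) (A : Type v) [CommRing R] [Ring A]
    [Algebra R A] : Prop where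
  isReduced_base : IsReduced R
  isPseudoNoetherian_base : IsPseudoNoetherianRing R
  isPseudoNoetherian : IsPseudoNoetherianAlgebra R A
  hasNoNilpotentIdeals : HasNoNilpotentIdeals A
  isTorsionFree : Module.IsTorsionFree R A

/-- The set of prime ideals of `R` of height `1`, as a type. -/
abbrev HeightOnePrime (R : Type u) [CommRing R] : Type u :=
  {P : PrimeSpectrum R // P.asIdeal.height = 1}

/-- The localization `M_P` of an `A`-module `M` at a prime ideal `P` of the base ring `R`, with
its `A`-module structure. -/
abbrev LocalizationAtPrime {R : Type u} [CommRing R] (P : PrimeSpectrum R) (M : Type w)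
    [AddCommGroup M] [Module R M] : Type (max u w) :=
  M ⊗[R] Localization.AtPrime P.asIdeal

/-- `QM`, where `Q` is the full ring of fractions of `R`, with its `A`-module structure. -/
abbrev FractionModule (R : Type u) [CommRing R] (M : Type w) [AddCommGroup M] [Module R M] :
    Type (max u w) :=
  M ⊗[R] FractionRing R

/-- The submodule `{x ∈ QM | ∀ P of height one, ∃ r ∈ R \ P, r x ∈ M}` of `QM`. Here `M` stands for
its image in `QM`, to which it is identified when it is torsion free. -/
def divisorialHull (R : Type u) (A : Type v) [CommRing R] [Ring A] [Algebra R A] (M : Type w)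
    [AddCommGroup M] [Module R M] [Module A M] [IsScalarTower R A M] :
    Submodule A (FractionModule R M) where
  carrier := {x | ∀ P : HeightOnePrime R, ∃ r : R, r ∉ P.1.asIdeal ∧
    ∃ m : M, r • x = m ⊗ₜ[R] (1 : FractionRing R)}
  zero_mem' P := ⟨1, P.1.asIdeal.one_notMem, 0, by simp⟩
  add_mem' := by
    intro x y hx hy P
    obtain ⟨r, hr, m, hm⟩ := hx P
    obtain ⟨s, hs, n, hn⟩ := hy P
    refine ⟨r * s, P.1.asIdeal.primeCompl.mul_mem hr hs, s • m + r • n, ?_⟩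
    rw [smul_add, mul_smul, mul_smul, hn, smul_comm r s x, hm, TensorProduct.add_tmul,
      TensorProduct.smul_tmul', TensorProduct.smul_tmul']
  smul_mem' := by
    intro a x hx P
    obtain ⟨r, hr, m, hm⟩ := hx P
    exact ⟨r, hr, a • m, by rw [smul_comm r a x, hm, TensorProduct.smul_tmul']⟩

section SerreQuotient

variable (R : Type u) (A : Type v) [CommRing R] [Ring A] [Algebra R A]

/-- The full subcategory of `A`-modules `M` such that `M_P = 0` for every prime ideal `P` of `R`
of height `1`. -/
def codimTwoModules : ObjectProperty (ModuleCat.{w} A) := fun M =>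
  letI : Module R M := Module.compHom M (algebraMap R A)
  ∀ P : HeightOnePrime R, Subsingleton (LocalizationAtPrime P.1 M)

theorem codimTwoModules_iff (M : ModuleCat.{w} A) :
    codimTwoModules R A M ↔ ∀ (P : HeightOnePrime R) (m : M),
      ∃ r : R, r ∉ P.1.asIdeal ∧ algebraMap R A r • m = 0 := by
  let _ : Module R M := Module.compHom M (algebraMap R A)
  refine forall_congr' fun P => ?_
  rw [(TensorProduct.comm R M (Localization.AtPrime P.1.asIdeal)).subsingleton_congr,
    IsLocalizedModule.subsingleton_iff P.1.asIdeal.primeCompl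
      (TensorProduct.mk R (Localization.AtPrime P.1.asIdeal) M 1)]
  rfl

instance codimTwoModules_isSerreClass : (codimTwoModules.{u, v, w} R A).IsSerreClass where
  exists_zero := ⟨ModuleCat.of A PUnit, ModuleCat.isZero_of_subsingleton _, by
    rw [codimTwoModules_iff]
    exact fun P m => ⟨1, P.1.asIdeal.one_notMem, rfl⟩⟩
  prop_of_mono {M N} f hf hN := by
    rw [ModuleCat.mono_iff_injective] at hf
    rw [codimTwoModules_iff] at hN ⊢
    intro P m
    obtain ⟨r, hr, h⟩ := hN P (f m)
    exact ⟨r, hr, hf (by simpa using h)⟩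
  prop_of_epi {M N} f hf hM := by
    rw [ModuleCat.epi_iff_surjective] at hf
    rw [codimTwoModules_iff] at hM ⊢
    intro P n
    obtain ⟨m, rfl⟩ := hf n
    obtain ⟨r, hr, h⟩ := hM P m
    exact ⟨r, hr, by rw [← map_smul, h, map_zero]⟩
  prop_X₂_of_shortExact {S} hS h₁ h₃ := by
    rw [codimTwoModules_iff] at h₁ h₃ ⊢
    intro P x
    obtain ⟨r, hr, h⟩ := h₃ P (S.g x)
    obtain ⟨y, hy⟩ := (ShortComplex.moduleCat_exact_iff S).1 hS.exact (algebraMap R A r • x)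
      (by rw [map_smul, h])
    obtain ⟨s, hs, h'⟩ := h₁ P y
    refine ⟨s * r, P.1.asIdeal.primeCompl.mul_mem hs hr, ?_⟩
    rw [map_mul, mul_smul, ← hy, ← map_smul, h', map_zero]

/-- The quotient of the category of `A`-modules by the Serre subcategory `codimTwoModules R A`:
the localization at all homomorphisms with kernel and cokernel in that subcategory. -/
abbrev QuotientModuleCat : Type (max v (w + 1)) :=
  (codimTwoModules.{u, v, w} R A).isoModSerre.Localization

/-- The quotient functor from `A`-modules to the quotient category. -/
abbrev quotientFunctor : ModuleCat.{w} A ⥤ QuotientModuleCat.{u, v, w} R A :=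
  (codimTwoModules.{u, v, w} R A).isoModSerre.Q

end SerreQuotient

end

/-!
Call an `A`-module `L` closed if `Hom(-, L)` inverts all homomorphisms with kernel and cokernel in
the Serre subcategory `𝒳 = codimTwoModules R A`. These homomorphisms admit a calculus of left
fractions, so that `Hom(N, L) = Hom(FN, FL)` for closed `L` (`isLocal.bijective_map`). Therefore, if
every `M` has a homomorphism `M → L` to a closed module with kernel and cokernel in `𝒳`, then
`F` has a right adjoint `G`, and `GFM ≃ L` for any such `L`.

Closed modules are plentiful. A module on which a multiplicative set `S ⊆ R` acts invertibly is
closed as soon as all modules in `𝒳` are `S`-torsion (`isCodimTwoClosed_of_bijective_smul`); this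
applies to `M_P` for every `P` of height one. Products of closed modules are closed, and so is the
saturation `{x ∈ L | ∀ P, ∃ r ∉ P, r x ∈ K}` of a submodule `K` of a closed module `L`. If `M → L` is
a homomorphism to a closed module with kernel in `𝒳`, then `GFM` is the saturation of its image
(`nonempty_rightAdjoint_obj_linearEquiv_codimTwoSaturation`). With `L = ∏ M_P` this gives the
existence of `G`.

If every minimal prime lies below a prime of height one, then prime avoidance, applied to the
finitely many minimal primes of the reduced ring `R`, shows that modules in `𝒳` are torsion. Thus
`QM` is closed, and for `M` torsion free, the saturation of `M` in `QM` is `M_𝒫` by definition.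

If `M` is torsion, then its saturation in `∏ M_P` is `⨁ M_P`. The image of `m ∈ M` has finite support,
for if `r m = 0` with a non-zero-divisor `r`, then the primes of height one that contain `r` are
minimal over `r`, and there are finitely many of these. A similar argument shows that `⨁ M_P` is
saturated (`finite_support_of_forall_smul`). Finally, `(M_{P'})_P = 0` for `P ≠ P'`
(`exists_smul_eq_zero_of_isTorsion`), so `⨁ M_P` lies in the saturation of `M`.
-/

noncomputable section

/-! ### Local objects and right adjoints of localization functors -/

namespace CategoryTheory.MorphismProperty

variable {C D : Type*} [Category* C] [Category* D] (F : C ⥤ D) (W : MorphismProperty C)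
  [F.IsLocalization W] [W.HasLeftCalculusOfFractions]

/-- Morphisms into a local object do not change under localization: every morphism of `W` out of
`Z` is a split monomorphism, so the denominator of a left fraction can be removed. -/
theorem isLocal.bijective_map {Z : C} (hZ : W.isLocal Z) (X : C) :
    Function.Bijective (F.map : (X ⟶ Z) → (F.obj X ⟶ F.obj Z)) := by
  have retraction {Z' : C} (s : Z ⟶ Z') (hs : W s) : ∃ r, s ≫ r = 𝟙 Z := (hZ s hs).2 (𝟙 Z)
  refine ⟨fun f g hfg => ?_, fun φ => ?_⟩
  · obtain ⟨Z', s, hs, h⟩ := (map_eq_iff_postcomp F W f g).1 hfg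
    obtain ⟨r, hr⟩ := retraction s hs
    rw [← Category.comp_id f, ← Category.comp_id g, ← hr, reassoc_of% h]
  · obtain ⟨ψ, hψ⟩ := Localization.exists_leftFraction F W φ
    obtain ⟨r, hr⟩ := retraction ψ.s ψ.hs
    refine ⟨ψ.f ≫ r, ?_⟩
    have := Localization.inverts F W _ ψ.hs
    rw [hψ, F.map_comp, ← cancel_mono (F.map ψ.s), LeftFraction.map_comp_map_s]
    have h : F.map r ≫ F.map ψ.s = 𝟙 _ := by
      rw [← cancel_epi (F.map ψ.s), ← F.map_comp_assoc, hr]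
      simp
    rw [Category.assoc, h, Category.comp_id]

/-- A local object `Z` represents the presheaf `Hom(F -, Y)`, when `F Z ≅ Y`. -/
def isLocal.representableBy {Z : C} (hZ : W.isLocal Z) {Y : D} (e : F.obj Z ≅ Y) :
    (F.op ⋙ yoneda.obj Y).RepresentableBy Z where
  homEquiv {X} := (Equiv.ofBijective _ (hZ.bijective_map F W X)).trans e.homToEquiv
  homEquiv_comp f g := by simp

theorem isLeftAdjoint_of_exists_isLocal
    (h : ∀ M : C, ∃ (Z : C) (s : M ⟶ Z), W s ∧ W.isLocal Z) : F.IsLeftAdjoint := by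
  refine Functor.isLeftAdjoint_of_rightAdjointObjIsDefined_eq_top ?_
  ext Y
  have := Localization.essSurj F W
  obtain ⟨Z, s, hs, hZ⟩ := h (F.objPreimage Y)
  have := Localization.inverts F W s hs
  simpa [Functor.rightAdjointObjIsDefined_iff] using
    (hZ.representableBy F W ((asIso (F.map s)).symm ≪≫ F.objObjPreimageIso Y)).isRepresentable

theorem nonempty_rightAdjoint_obj_iso {G : D ⥤ C} (adj : F ⊣ G) {M Z : C} (s : M ⟶ Z) (hs : W s)
    (hZ : W.isLocal Z) : Nonempty (G.obj (F.obj M) ≅ Z) := by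
  have := Localization.inverts F W s hs
  exact ⟨(adj.representableBy (F.obj M)).uniqueUpToIso
    (hZ.representableBy F W (asIso (F.map s)).symm)⟩

end CategoryTheory.MorphismProperty

/-! ### Closed modules -/

section CodimTwoClosed

variable (R : Type u) (A : Type v) [CommRing R] [Ring A] [Algebra R A]

/-- The morphisms inverted by the quotient functor, in terms of elements. -/
theorem isoModSerre_codimTwoModules_iff {X Y : ModuleCat.{w} A} (f : X ⟶ Y) :
    (codimTwoModules R A).isoModSerre f ↔ ∀ P : HeightOnePrime R,
      (∀ x : X, f x = 0 → ∃ r : R, r ∉ P.1.asIdeal ∧ algebraMap R A r • x = 0) ∧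
      (∀ y : Y, ∃ r : R, r ∉ P.1.asIdeal ∧ ∃ x : X, f x = algebraMap R A r • y) := by
  rw [ObjectProperty.isoModSerre_iff, ObjectProperty.monoModSerre_iff,
    ObjectProperty.epiModSerre_iff,
    (codimTwoModules R A).prop_iff_of_iso (ModuleCat.kernelIsoKer f),
    (codimTwoModules R A).prop_iff_of_iso (ModuleCat.cokernelIsoRangeQuotient f),
    codimTwoModules_iff, codimTwoModules_iff, ← forall_and]
  refine forall_congr' fun P => and_congr ?_ ?_
  · constructor
    · intro h x hx
      obtain ⟨r, hr, h⟩ := h ⟨x, hx⟩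
      exact ⟨r, hr, congrArg Subtype.val h⟩
    · rintro h ⟨x, hx⟩
      obtain ⟨r, hr, h⟩ := h x hx
      exact ⟨r, hr, Subtype.ext h⟩
  · rw [(Submodule.Quotient.mk_surjective _).forall]
    refine forall_congr' fun y => exists_congr fun r => and_congr_right fun _ => ?_
    rw [← Submodule.Quotient.mk_smul, Submodule.Quotient.mk_eq_zero]
    rfl

/-- An `A`-module is closed with respect to the Serre subcategory `codimTwoModules R A` if
`Hom(-, L)` turns all homomorphisms with kernel and cokernel in that subcategory into bijections. -/
def IsCodimTwoClosed (L : Type w) [AddCommGroup L] [Module A L] : Prop :=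
  (codimTwoModules.{u, v, w} R A).isoModSerre.isLocal (ModuleCat.of A L)

variable {R A} {L : Type w} [AddCommGroup L] [Module A L]

/-- If the kernel and the cokernel of `f : N → N'` are `S`-torsion and `S` acts invertibly on `L`,
then every homomorphism `N → L` extends uniquely along `f`. (`f` becomes an isomorphism
after localization at `S`, through which homomorphisms to `L` factor.) -/
theorem bijective_comp_of_bijective_smul (S : Submonoid R)
    (hL : ∀ s ∈ S, Function.Bijective fun x : L => algebraMap R A s • x)
    {N N' : Type w} [AddCommGroup N] [Module A N] [AddCommGroup N'] [Module A N'] (f : N →ₗ[A] N')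
    (hker : ∀ n, f n = 0 → ∃ s ∈ S, algebraMap R A s • n = 0)
    (hcoker : ∀ n', ∃ s ∈ S, ∃ n, f n = algebraMap R A s • n') :
    Function.Bijective fun g : N' →ₗ[A] L => g ∘ₗ f := by
  have comm (r : R) (a : A) {X : Type w} [AddCommGroup X] [Module A X] (x : X) :
      algebraMap R A r • a • x = a • algebraMap R A r • x := by
    rw [← mul_smul, ← mul_smul, Algebra.commutes]
  refine ⟨fun g₁ g₂ h => LinearMap.ext fun n' => ?_, fun g => ?_⟩
  · obtain ⟨s, hs, n, hn⟩ := hcoker n'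
    refine (hL s hs).1 ?_
    simpa [← map_smul, ← hn] using LinearMap.congr_fun h n
  · -- The extension of `g` sends `n'` to the only `l` with `s n' = f n`, `s l = g n` for some
    -- `s ∈ S` and some `n`.
    have unique {n' : N'} {l l' : L} {s s' : R} {n m : N} (hs : s ∈ S) (hs' : s' ∈ S)
        (hn : f n = algebraMap R A s • n') (hm : f m = algebraMap R A s' • n')
        (hl : g n = algebraMap R A s • l) (hl' : g m = algebraMap R A s' • l') : l = l' := by
      obtain ⟨t, ht, h⟩ := hker (algebraMap R A s' • n - algebraMap R A s • m) (by
        rw [map_sub, map_smul, map_smul, hn, hm, comm, sub_self])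
      have h' := congrArg g h
      rw [map_smul, map_sub, map_smul, map_smul, hl, hl', map_zero, comm s', ← smul_sub,
        ← smul_sub] at h'
      have key (r : R) (hr : r ∈ S) (x : L) (hx : algebraMap R A r • x = 0) : x = 0 :=
        (hL r hr).1 (by simpa using hx)
      exact sub_eq_zero.1 (key s' hs' _ (key s hs _ (key t ht _ h')))
    have exist (n' : N') : ∃ l, ∃ s ∈ S, ∃ n, f n = algebraMap R A s • n' ∧
        g n = algebraMap R A s • l := by
      obtain ⟨s, hs, n, hn⟩ := hcoker n'
      obtain ⟨l, hl⟩ := (hL s hs).2 (g n)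
      exact ⟨l, s, hs, n, hn, hl.symm⟩
    choose φ s hs ν hν hφ using exist
    refine ⟨{ toFun := φ, map_add' := fun x y => ?_, map_smul' := fun a x => ?_ },
      LinearMap.ext fun n => ?_⟩
    · refine unique (hs (x + y)) (S.mul_mem (hs x) (hs y)) (hν (x + y))
        (m := algebraMap R A (s y) • ν x + algebraMap R A (s x) • ν y) ?_ (hφ _) ?_
      · rw [map_add, map_smul, map_smul, hν, hν, map_mul, smul_add, mul_smul, mul_smul, comm (s y)]
      · rw [map_add, map_smul, map_smul, hφ, hφ, map_mul, smul_add, mul_smul, mul_smul, comm (s y)]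
    · refine unique (hs (a • x)) (hs x) (hν (a • x)) (m := a • ν x) ?_ (hφ _) ?_
      · rw [map_smul, hν, comm]
      · rw [map_smul, hφ, comm, RingHom.id_apply]
    · exact unique (hs (f n)) S.one_mem (hν (f n)) (m := n) (by simp) (hφ _) (by simp)

theorem isCodimTwoClosed_iff : IsCodimTwoClosed R A L ↔
    ∀ {N N' : ModuleCat.{w} A} (f : N ⟶ N'), (codimTwoModules R A).isoModSerre f →
      Function.Bijective fun g : N' →ₗ[A] L => g ∘ₗ f.hom := by
  refine forall_congr' fun N => forall_congr' fun N' => forall_congr' fun f =>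
    imp_congr_right fun _ => ?_
  rw [← Function.Bijective.of_comp_iff' (f := ModuleCat.homEquiv (M := N) (N := ModuleCat.of A L))
    (Equiv.bijective _), ← Function.Bijective.of_comp_iff _
      (ModuleCat.homEquiv (M := N') (N := ModuleCat.of A L)).bijective]
  rfl

/-- The condition `hS` says that every module in `codimTwoModules R A` is `S`-torsion. -/
theorem isCodimTwoClosed_of_bijective_smul (S : Submonoid R)
    (hL : ∀ s ∈ S, Function.Bijective fun x : L => algebraMap R A s • x)
    (hS : ∀ I : Ideal R, (∀ P : HeightOnePrime R, ¬ I ≤ P.1.asIdeal) → ∃ s ∈ S, s ∈ I) :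
    IsCodimTwoClosed R A L := by
  rw [isCodimTwoClosed_iff]
  intro N N' f hf
  rw [isoModSerre_codimTwoModules_iff] at hf
  let _ : Module R N := Module.compHom N (algebraMap R A)
  let _ : Module R N' := Module.compHom N' (algebraMap R A)
  refine bijective_comp_of_bijective_smul S hL f.hom (fun n hn => ?_) (fun n' => ?_)
  · -- The annihilator of `n` in `R`.
    obtain ⟨s, hs, h⟩ := hS (LinearMap.ker (LinearMap.toSpanSingleton R N n)) fun P hP => by
      obtain ⟨r, hr, h⟩ := (hf P).1 n hn
      exact hr (hP h)
    exact ⟨s, hs, h⟩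
  · -- The annihilator of the class of `n'` in the cokernel.
    obtain ⟨s, hs, h⟩ := hS (Submodule.comap (LinearMap.toSpanSingleton R N' n')
      { toAddSubmonoid := (LinearMap.range f.hom).toAddSubmonoid
        smul_mem' := fun r _ h => (LinearMap.range f.hom).smul_mem (algebraMap R A r) h })
      fun P hP => by
        obtain ⟨r, hr, h⟩ := (hf P).2 n'
        exact hr (hP h)
    exact ⟨s, hs, h⟩

theorem IsCodimTwoClosed.pi {ι : Type w} {L : ι → Type w} [∀ i, AddCommGroup (L i)]
    [∀ i, Module A (L i)] (hL : ∀ i, IsCodimTwoClosed R A (L i)) :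
    IsCodimTwoClosed R A (∀ i, L i) := by
  simp only [isCodimTwoClosed_iff] at hL ⊢
  refine fun f hf => ⟨fun g₁ g₂ h => ?_, fun g => ?_⟩
  · refine LinearMap.ext fun n' => funext fun i => ?_
    have := (hL i f hf).1 (a₁ := LinearMap.proj i ∘ₗ g₁) (a₂ := LinearMap.proj i ∘ₗ g₂)
      (LinearMap.ext fun n => congrFun (LinearMap.congr_fun h n) i)
    exact LinearMap.congr_fun this n'
  · choose φ hφ using fun i => (hL i f hf).2 (LinearMap.proj i ∘ₗ g)
    exact ⟨LinearMap.pi φ, LinearMap.ext fun n => funext fun i => LinearMap.congr_fun (hφ i) n⟩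

variable (R) in
/-- The saturation of a submodule `K ⊆ L`: the inverse image of the largest submodule of `L ⧸ K`
that lies in `codimTwoModules R A`. -/
def codimTwoSaturation (K : Submodule A L) : Submodule A L where
  carrier := {x | ∀ P : HeightOnePrime R, ∃ r ∉ P.1.asIdeal, algebraMap R A r • x ∈ K}
  zero_mem' P := ⟨1, P.1.asIdeal.one_notMem, by simp⟩
  add_mem' {x y} hx hy P := by
    obtain ⟨r, hr, hx⟩ := hx P
    obtain ⟨s, hs, hy⟩ := hy P
    refine ⟨r * s, P.1.asIdeal.primeCompl.mul_mem hr hs, ?_⟩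
    rw [smul_add]
    refine K.add_mem ?_ ?_
    · rw [mul_comm, map_mul, mul_smul]
      exact K.smul_mem _ hx
    · rw [map_mul, mul_smul]
      exact K.smul_mem _ hy
  smul_mem' a x hx P := by
    obtain ⟨r, hr, hx⟩ := hx P
    refine ⟨r, hr, ?_⟩
    rw [← mul_smul, Algebra.commutes, mul_smul]
    exact K.smul_mem a hx

theorem le_codimTwoSaturation (K : Submodule A L) : K ≤ codimTwoSaturation R K :=
  fun x hx P => ⟨1, P.1.asIdeal.one_notMem, by simpa⟩

theorem mem_codimTwoSaturation_of_forall_smul_mem {K : Submodule A L} {x : L}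
    (h : ∀ P : HeightOnePrime R, ∃ r ∉ P.1.asIdeal,
      algebraMap R A r • x ∈ codimTwoSaturation R K) : x ∈ codimTwoSaturation R K := by
  intro P
  obtain ⟨r, hr, h⟩ := h P
  obtain ⟨s, hs, h⟩ := h P
  exact ⟨s * r, P.1.asIdeal.primeCompl.mul_mem hs hr, by rwa [map_mul, mul_smul]⟩

theorem IsCodimTwoClosed.codimTwoSaturation (hL : IsCodimTwoClosed R A L) (K : Submodule A L) :
    IsCodimTwoClosed R A (codimTwoSaturation R K) := by
  rw [isCodimTwoClosed_iff] at hL ⊢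
  refine fun {N N'} f hf => ⟨fun g₁ g₂ h => ?_, fun g => ?_⟩
  · have := (hL f hf).1 (a₁ := Submodule.subtype _ ∘ₗ g₁) (a₂ := Submodule.subtype _ ∘ₗ g₂)
      (LinearMap.ext fun n => congrArg Subtype.val (LinearMap.congr_fun h n))
    exact LinearMap.ext fun n' => Subtype.ext (LinearMap.congr_fun this n')
  · obtain ⟨φ, hφ⟩ := (hL f hf).2 (Submodule.subtype _ ∘ₗ g)
    have hφ' (n : N) : φ (f.hom n) = g n := LinearMap.congr_fun hφ n
    refine ⟨φ.codRestrict _ fun n' => mem_codimTwoSaturation_of_forall_smul_mem fun P => ?_,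
      LinearMap.ext fun n => Subtype.ext (hφ' n)⟩
    obtain ⟨r, hr, n, hn⟩ := ((isoModSerre_codimTwoModules_iff R A f).1 hf P).2 n'
    refine ⟨r, hr, ?_⟩
    rw [← map_smul, ← hn]
    exact hφ' n ▸ (g n).2

theorem isoModSerre_codRestrict_codimTwoSaturation {M : Type w} [AddCommGroup M] [Module A M]
    (f : M →ₗ[A] L)
    (hf : ∀ x, f x = 0 → ∀ P : HeightOnePrime R, ∃ r ∉ P.1.asIdeal, algebraMap R A r • x = 0) :
    (codimTwoModules R A).isoModSerre (ModuleCat.ofHom (f.codRestrict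
      (codimTwoSaturation R (LinearMap.range f)) fun x => le_codimTwoSaturation _ ⟨x, rfl⟩)) := by
  rw [isoModSerre_codimTwoModules_iff]
  refine fun P => ⟨fun x hx => hf x (congrArg Subtype.val hx) P, fun y => ?_⟩
  obtain ⟨r, hr, x, hx⟩ := y.2 P
  exact ⟨r, hr, x, Subtype.ext hx⟩

/-- The section functor is computed by saturating the image of `M` in any closed module that receives
a homomorphism from `M` with kernel in `codimTwoModules R A`. -/
theorem nonempty_rightAdjoint_obj_linearEquiv_codimTwoSaturation
    {G : QuotientModuleCat.{u, v, w} R A ⥤ ModuleCat.{w} A} (adj : quotientFunctor R A ⊣ G)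
    {M : Type w} [AddCommGroup M] [Module A M] (hL : IsCodimTwoClosed R A L) (f : M →ₗ[A] L)
    (hf : ∀ x, f x = 0 → ∀ P : HeightOnePrime R, ∃ r ∉ P.1.asIdeal, algebraMap R A r • x = 0) :
    Nonempty (G.obj ((quotientFunctor R A).obj (ModuleCat.of A M)) ≃ₗ[A]
      codimTwoSaturation R (LinearMap.range f)) := by
  obtain ⟨e⟩ := MorphismProperty.nonempty_rightAdjoint_obj_iso (quotientFunctor R A)
    (codimTwoModules R A).isoModSerre adj _ (isoModSerre_codRestrict_codimTwoSaturation f hf)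
    (hL.codimTwoSaturation _)
  exact ⟨e.toLinearEquiv⟩

end CodimTwoClosed

/-! ### The localization of a module as a tensor product -/

section Localization

variable {R : Type*} {A : Type*} [CommRing R] [Ring A] [Algebra R A] (S : Submonoid R)
  {M : Type*} [AddCommGroup M] [Module R M]

instance isLocalizedModule_mk_flip :
    IsLocalizedModule S ((TensorProduct.mk R M (Localization S)).flip 1) :=
  IsLocalizedModule.of_linearEquiv S (TensorProduct.mk R (Localization S) M 1)
    (TensorProduct.comm R (Localization S) M)

variable [Module A M] [IsScalarTower R A M]
variable (A M) in
/-- The canonical map from `M` to its localization, as an `A`-linear map. -/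
def tensorLocalizationMap : M →ₗ[A] M ⊗[R] Localization S where
  toFun m := m ⊗ₜ 1
  map_add' x y := TensorProduct.add_tmul x y 1
  map_smul' a x := (TensorProduct.smul_tmul' a x 1).symm

theorem bijective_smul_tensor_localization (s : R) (hs : s ∈ S) :
    Function.Bijective fun x : M ⊗[R] Localization S => algebraMap R A s • x := by
  simp only [algebraMap_smul]
  exact (Module.End.isUnit_iff _).1 (IsLocalizedModule.map_units
    ((TensorProduct.mk R M (Localization S)).flip 1) ⟨s, hs⟩)

theorem tensorLocalizationMap_eq_zero_iff {m : M} : tensorLocalizationMap A S M m = 0 ↔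
    ∃ s ∈ S, s • m = 0 := by
  refine (IsLocalizedModule.eq_zero_iff S ((TensorProduct.mk R M (Localization S)).flip 1)).trans ?_
  simp [Submonoid.smul_def]

theorem exists_smul_eq_tensorLocalizationMap (x : M ⊗[R] Localization S) :
    ∃ s ∈ S, ∃ m, s • x = tensorLocalizationMap A S M m := by
  obtain ⟨⟨m, s⟩, h⟩ := IsLocalizedModule.surj S ((TensorProduct.mk R M (Localization S)).flip 1) x
  exact ⟨s, s.2, m, h⟩

end Localization

/-! ### Prime ideals of height one -/

section HeightOne

variable {R : Type u} [CommRing R]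

theorem mem_minimalPrimes_of_lt_heightOnePrime {p : Ideal R} [p.IsPrime] (P : HeightOnePrime R)
    (h : p < P.1.asIdeal) : p ∈ minimalPrimes R := by
  have := Ideal.height_add_one_le_of_lt_of_isPrime h
  rw [P.2] at this
  rw [← Ideal.height_eq_zero_iff]
  generalize p.height = n at this
  enat_to_nat
  lia

/-- Prime avoidance for a set of minimal primes. -/
theorem exists_mem_forall_notMem_of_finite_minimalPrimes (hR : (minimalPrimes R).Finite)
    {I : Ideal R} (T : Set (Ideal R)) (hT : T ⊆ minimalPrimes R) (hI : ∀ p ∈ T, ¬ I ≤ p) :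
    ∃ r ∈ I, ∀ p ∈ T, r ∉ p := by
  by_contra! h
  have hfin := hR.subset hT
  obtain ⟨p, hp, hIp⟩ := (Ideal.subset_union_prime (s := hfin.toFinset) (f := id) ⊥ ⊥
    (fun p hp _ _ => (hT (hfin.mem_toFinset.1 hp)).isPrime) (I := I)).1 fun r hr => by
      obtain ⟨p, hp, hrp⟩ := h r hr
      exact Set.mem_biUnion (by simpa using hp) hrp
  exact hI p (hfin.mem_toFinset.1 hp) hIp

theorem mem_nonZeroDivisors_of_forall_notMem_minimalPrimes [IsReduced R] {r : R}
    (hr : ∀ p ∈ minimalPrimes R, r ∉ p) : r ∈ R⁰ := by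
  rw [mem_nonZeroDivisors_iff_right]
  intro x hx
  have : x ∈ (⊥ : Ideal R).radical := by
    rw [← Ideal.sInf_minimalPrimes, Ideal.mem_sInf]
    intro p hp
    exact (hp.isPrime.mem_or_mem (hx ▸ p.zero_mem : x * r ∈ p)).resolve_right (hr p hp)
  obtain ⟨n, hn⟩ := this
  exact IsReduced.eq_zero x ⟨n, hn⟩

/-- If `r` lies in no minimal prime below a prime of height one, then every prime of height one that
contains `r` is minimal over `r`. -/
theorem finite_setOf_mem_heightOnePrime {r : R} (hfin : (Ideal.span {r}).minimalPrimes.Finite)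
    (hr : ∀ p ∈ minimalPrimes R, ∀ P : HeightOnePrime R, p ≤ P.1.asIdeal → r ∉ p) :
    {P : HeightOnePrime R | r ∈ P.1.asIdeal}.Finite := by
  refine hfin.of_injOn (f := fun P => P.1.asIdeal) (fun P hP => ?_)
    fun P _ P' _ h => Subtype.ext (PrimeSpectrum.ext h)
  refine ⟨⟨P.1.2, (Ideal.span_singleton_le_iff_mem _).2 hP⟩, fun q hq hqP => ?_⟩
  have := hq.1
  rcases hqP.eq_or_lt with h | h
  · exact h.ge
  · exact (hr q (mem_minimalPrimes_of_lt_heightOnePrime P h) P hqP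
      ((Ideal.span_singleton_le_iff_mem _).1 hq.2)).elim

/-- Otherwise the multiplicative set generated by the complements of `P` and `P'` does not meet `(r)`,
so that some prime ideal containing `r` lies in both `P` and `P'`. It is strictly smaller than one
of them and hence minimal, but minimal primes consist of zero divisors. -/
theorem exists_dvd_mul_of_ne_heightOnePrime {P P' : HeightOnePrime R} (hP : P ≠ P') {r : R}
    (hr : r ∈ R⁰) : ∃ y ∉ P.1.asIdeal, ∃ s ∉ P'.1.asIdeal, r ∣ y * s := by
  by_contra! h
  obtain ⟨q, hq, hrq, hdisj⟩ := Ideal.exists_le_prime_disjoint (Ideal.span {r})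
    (P.1.asIdeal.primeCompl ⊔ P'.1.asIdeal.primeCompl) <| Set.disjoint_left.2 fun x hx hx' => by
      obtain ⟨y, hy, s, hs, rfl⟩ := Submonoid.mem_sup.1 hx'
      exact h y hy s hs (Ideal.mem_span_singleton.1 hx)
  have hqP : q ≤ P.1.asIdeal := fun x hx => by
    by_contra hxP
    exact Set.disjoint_left.1 hdisj hx (Submonoid.mem_sup_left hxP)
  have hqP' : q ≤ P'.1.asIdeal := fun x hx => by
    by_contra hxP
    exact Set.disjoint_left.1 hdisj hx (Submonoid.mem_sup_right hxP)
  refine notMem_nonZeroDivisors_of_mem_mem_minimalPrimes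
    ((Ideal.span_singleton_le_iff_mem _).1 hrq) ?_ hr
  rcases hqP.eq_or_lt with rfl | h
  · refine mem_minimalPrimes_of_lt_heightOnePrime P' (hqP'.lt_of_ne fun h => ?_)
    exact hP (Subtype.ext (PrimeSpectrum.ext h))
  · exact mem_minimalPrimes_of_lt_heightOnePrime P h

end HeightOne

/-! ### Localizations and modules of fractions are closed -/

section SectionFunctor

variable {R A M : Type u} [CommRing R] [Ring A] [Algebra R A]
  [AddCommGroup M] [Module R M] [Module A M] [IsScalarTower R A M]

theorem isCodimTwoClosed_localizationAtPrime (P : HeightOnePrime R) :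
    IsCodimTwoClosed R A (LocalizationAtPrime P.1 M) := by
  refine isCodimTwoClosed_of_bijective_smul P.1.asIdeal.primeCompl
    (bijective_smul_tensor_localization _) fun I hI => ?_
  obtain ⟨s, hs, hsP⟩ := SetLike.not_le_iff_exists.1 (hI P)
  exact ⟨s, hsP, hs⟩

/-- An ideal contained in no prime of height one is contained in no minimal prime either, and so
contains a non-zero-divisor. Hence modules in `codimTwoModules R A` are torsion. -/
theorem isCodimTwoClosed_fractionModule [IsReduced R] (hfin : (minimalPrimes R).Finite)
    (hR : ∀ N ∈ minimalPrimes R, ∃ P : HeightOnePrime R, N ≤ P.1.asIdeal) :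
    IsCodimTwoClosed R A (FractionModule R M) := by
  refine isCodimTwoClosed_of_bijective_smul R⁰ (bijective_smul_tensor_localization _) fun I hI => ?_
  obtain ⟨r, hr, h⟩ := exists_mem_forall_notMem_of_finite_minimalPrimes hfin (I := I) _ subset_rfl
    fun p hp hIp => by
      obtain ⟨P, hP⟩ := hR p hp
      exact hI P (hIp.trans hP)
  exact ⟨r, mem_nonZeroDivisors_of_forall_notMem_minimalPrimes h, hr⟩

variable (R A M) in
/-- The canonical map `M → ∏ M_P`, over the primes `P` of height one. -/
def toPiLocalizationAtPrime : M →ₗ[A] ∀ P : HeightOnePrime R, LocalizationAtPrime P.1 M :=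
  LinearMap.pi fun P => tensorLocalizationMap A P.1.asIdeal.primeCompl M

theorem isCodimTwoClosed_pi_localizationAtPrime :
    IsCodimTwoClosed R A (∀ P : HeightOnePrime R, LocalizationAtPrime P.1 M) :=
  IsCodimTwoClosed.pi isCodimTwoClosed_localizationAtPrime

theorem exists_smul_eq_zero_of_toPiLocalizationAtPrime_eq_zero (x : M)
    (hx : toPiLocalizationAtPrime R A M x = 0) (P : HeightOnePrime R) :
    ∃ r ∉ P.1.asIdeal, algebraMap R A r • x = 0 := by
  obtain ⟨r, hr, h⟩ := (tensorLocalizationMap_eq_zero_iff (A := A) _).1 (congrFun hx P)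
  exact ⟨r, hr, by rwa [algebraMap_smul]⟩

theorem codimTwoSaturation_range_fractionModule :
    codimTwoSaturation R (LinearMap.range (tensorLocalizationMap A R⁰ M)) =
      divisorialHull R A M := by
  ext x
  refine forall_congr' fun P => exists_congr fun r => and_congr_right fun _ => ?_
  rw [algebraMap_smul]
  exact exists_congr fun m => eq_comm

theorem tensorLocalizationMap_nonZeroDivisors_eq_zero_iff [Module.IsTorsionFree R M] (x : M) :
    tensorLocalizationMap A R⁰ M x = 0 ↔ x = 0 := by
  rw [tensorLocalizationMap_eq_zero_iff]
  refine ⟨fun ⟨s, hs, h⟩ => ?_, fun h => ⟨1, one_mem _, by simp [h]⟩⟩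
  exact (isRegular_iff_mem_nonZeroDivisors.2 hs).isSMulRegular.right_eq_zero_of_smul h

/-! ### The saturation of a torsion module in the product of its localizations -/

/-- For a torsion module `M` and `P ≠ P'`, the localization of `M_{P'}` at `P` vanishes. -/
theorem exists_smul_eq_zero_of_isTorsion (hM : Module.IsTorsion R M) {P P' : HeightOnePrime R}
    (hP : P ≠ P') (x : LocalizationAtPrime P'.1 M) : ∃ y ∉ P.1.asIdeal, y • x = 0 := by
  obtain ⟨t, ht, m, hm⟩ := exists_smul_eq_tensorLocalizationMap (A := R) P'.1.asIdeal.primeCompl x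
  obtain ⟨⟨r, hr⟩, hrm⟩ := hM (x := m)
  obtain ⟨y, hy, s, hs, z, hz⟩ := exists_dvd_mul_of_ne_heightOnePrime hP hr
  refine ⟨y, hy, (bijective_smul_tensor_localization (A := R) _ (s * t)
    (mul_mem hs ht)).1 ?_⟩
  have hrm : r • m = 0 := hrm
  simp only [Algebra.algebraMap_self, RingHom.id_apply, smul_zero]
  rw [mul_smul, smul_comm t, hm, ← mul_smul, mul_comm, hz, ← map_smul, mul_comm, mul_smul, hrm,
    smul_zero, map_zero]

theorem finite_support_toPiLocalizationAtPrime (hR : IsPseudoNoetherianRing R)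
    (hM : Module.IsTorsion R M) (m : M) :
    {P : HeightOnePrime R | toPiLocalizationAtPrime R A M m P ≠ 0}.Finite := by
  obtain ⟨⟨r, hr⟩, hrm⟩ := hM (x := m)
  refine (finite_setOf_mem_heightOnePrime (hR.finite_minimalPrimes r) fun p hp _ _ h => ?_).subset
    fun P hP => ?_
  · exact notMem_nonZeroDivisors_of_mem_mem_minimalPrimes h hp hr
  · by_contra h
    exact hP ((tensorLocalizationMap_eq_zero_iff (A := A) _).2 ⟨r, h, hrm⟩)

/-- The families of finite support form a saturated submodule of `∏ M_P`. The multipliers `r` with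
`r x` of finite support form an ideal contained in no prime of height one. This ideal may lie in a
minimal prime that is not below any prime of height one; the chosen multiplier avoids only the
other minimal primes. This is enough for it to lie in finitely many primes of height one, and
it acts invertibly on `M_P` for all others. -/
theorem finite_support_of_forall_smul (hR : IsPseudoNoetherianRing R)
    (x : ∀ P : HeightOnePrime R, LocalizationAtPrime P.1 M)
    (hx : ∀ P : HeightOnePrime R, ∃ r ∉ P.1.asIdeal, {P' | r • x P' ≠ 0}.Finite) :
    {P | x P ≠ 0}.Finite := by
  let I : Ideal R :=
    { carrier := {r | {P | r • x P ≠ 0}.Finite}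
      zero_mem' := by simp
      add_mem' := fun {r s} hr hs => (hr.union hs).subset fun P hP => by
        by_contra! h
        simp only [Set.mem_union, Set.mem_ofPred_eq, not_or, not_not] at h
        exact hP (by rw [add_smul, h.1, h.2, add_zero])
      smul_mem' := fun a r hr => hr.subset fun P hP h => hP (by
        rw [smul_eq_mul, mul_smul, h, smul_zero]) }
  obtain ⟨r, hr, h⟩ := exists_mem_forall_notMem_of_finite_minimalPrimes (I := I)
    (T := {p ∈ minimalPrimes R | ∃ P : HeightOnePrime R, p ≤ P.1.asIdeal})
    (by simpa [minimalPrimes] using hR.finite_minimalPrimes 0) (Set.sep_subset _ _)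
    fun p ⟨_, P, hP⟩ hI => by
      obtain ⟨r, hr, h⟩ := hx P
      exact hr (hP (hI h))
  have hr' := finite_setOf_mem_heightOnePrime (hR.finite_minimalPrimes r)
    fun p hp P hP => h p ⟨hp, P, hP⟩
  refine (hr'.union hr).subset fun P hP => ?_
  by_contra! h'
  simp only [Set.mem_union, Set.mem_ofPred_eq, not_or] at h'
  refine hP ((bijective_smul_tensor_localization (A := R) P.1.asIdeal.primeCompl r h'.1).1 ?_)
  simpa using not_not.1 h'.2

variable (R A M) in
/-- The inclusion of the direct sum of the `M_P` into their product. -/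
def directSumToPi : (⨁ P : HeightOnePrime R, LocalizationAtPrime P.1 M) →ₗ[A]
    ∀ P : HeightOnePrime R, LocalizationAtPrime P.1 M where
  toFun x := x
  map_add' _ _ := rfl
  map_smul' _ _ := rfl

theorem directSumToPi_of_same [DecidableEq (HeightOnePrime R)] (P : HeightOnePrime R)
    (x : LocalizationAtPrime P.1 M) : directSumToPi R A M (DirectSum.of _ P x) P = x :=
  DirectSum.of_eq_same (β := fun P : HeightOnePrime R => LocalizationAtPrime P.1 M) P x

theorem directSumToPi_of_ne [DecidableEq (HeightOnePrime R)] {P Q : HeightOnePrime R} (h : Q ≠ P)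
    (x : LocalizationAtPrime P.1 M) : directSumToPi R A M (DirectSum.of _ P x) Q = 0 :=
  DirectSum.of_eq_of_ne (β := fun P : HeightOnePrime R => LocalizationAtPrime P.1 M) P Q x h

theorem mem_range_directSumToPi {x : ∀ P : HeightOnePrime R, LocalizationAtPrime P.1 M} :
    x ∈ LinearMap.range (directSumToPi R A M) ↔ {P | x P ≠ 0}.Finite := by
  classical
  refine ⟨?_, fun h => ⟨DirectSum.mk (fun P => LocalizationAtPrime P.1 M) h.toFinset
    fun P => x P, funext fun P => ?_⟩⟩
  · rintro ⟨x, rfl⟩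
    exact DFinsupp.finite_support x
  · refine (DFinsupp.mk_apply (β := fun P : HeightOnePrime R => LocalizationAtPrime P.1 M)
      (x := fun P : h.toFinset => x P)).trans ?_
    split_ifs with hP
    · rfl
    · exact (by simpa using hP : x P = 0).symm

theorem codimTwoSaturation_range_toPiLocalizationAtPrime (hR : IsPseudoNoetherianRing R)
    (hM : Module.IsTorsion R M) :
    codimTwoSaturation R (LinearMap.range (toPiLocalizationAtPrime R A M)) =
      LinearMap.range (directSumToPi R A M) := by
  classical
  refine le_antisymm (fun x hx => ?_) ?_
  · refine mem_range_directSumToPi.2 (finite_support_of_forall_smul hR x fun P => ?_)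
    obtain ⟨r, hr, m, hm⟩ := hx P
    rw [algebraMap_smul] at hm
    refine ⟨r, hr, ?_⟩
    exact (congrArg (fun z => {P | z P ≠ 0}.Finite) hm).mp
      (finite_support_toPiLocalizationAtPrime (A := A) hR hM m)
  · rintro _ ⟨x, rfl⟩
    induction x using DirectSum.induction_on with
    | zero => simp
    | add x y hx hy => rw [map_add]; exact add_mem hx hy
    | of P x =>
      intro P'
      by_cases hP : P' = P
      · subst hP
        -- A multiple of `m`, by elements outside `P'` that kill its other finitely many nonzero
        -- components, has image in the summand `M_{P'}`.
        obtain ⟨s, hs, m, hm⟩ :=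
          exists_smul_eq_tensorLocalizationMap (A := A) P'.1.asIdeal.primeCompl x
        let T := (finite_support_toPiLocalizationAtPrime (A := A) hR hM m).toFinset.erase P'
        choose! y hy hym using fun Q (hQ : P' ≠ Q) =>
          exists_smul_eq_zero_of_isTorsion hM hQ (toPiLocalizationAtPrime R A M m Q)
        have hyT : ∏ Q ∈ T, y Q ∈ P'.1.asIdeal.primeCompl :=
          prod_mem fun Q hQ => hy Q (Finset.ne_of_mem_erase hQ).symm
        refine ⟨(∏ Q ∈ T, y Q) * s, mul_mem hyT hs, (∏ Q ∈ T, y Q) • m, funext fun Q => ?_⟩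
        rw [LinearMap.map_smul_of_tower, algebraMap_smul, mul_smul]
        change (∏ Q ∈ T, y Q) • toPiLocalizationAtPrime R A M m Q =
          (∏ Q ∈ T, y Q) • s • directSumToPi R A M (DirectSum.of _ P' x) Q
        by_cases hQ : Q = P'
        · subst hQ
          rw [directSumToPi_of_same, hm]
          rfl
        · rw [directSumToPi_of_ne hQ, smul_zero, smul_zero]
          by_cases h : toPiLocalizationAtPrime R A M m Q = 0
          · rw [h, smul_zero]
          · rw [← Finset.prod_erase_mul _ _ (a := Q) (by simpa [T, hQ] using h), mul_smul,
              hym Q (Ne.symm hQ), smul_zero]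
      · obtain ⟨y, hy, h⟩ := exists_smul_eq_zero_of_isTorsion hM hP x
        refine ⟨y, hy, 0, ?_⟩
        rw [map_zero, ← map_smul, algebraMap_smul]
        refine (map_zero _).symm.trans (congrArg _ ?_)
        change 0 = y • DirectSum.lof R _ (fun P : HeightOnePrime R => LocalizationAtPrime P.1 M) P x
        rw [← map_smul, h, map_zero]

end SectionFunctor

theorem theorem1 (R A : Type u) [CommRing R] [Ring A] [Algebra R A]
    (hA : IsReducedPseudoNoetherianOrder R A) :
    (quotientFunctor.{u, u, u} R A).IsLeftAdjoint ∧
    ∀ (G : QuotientModuleCat.{u, u, u} R A ⥤ ModuleCat.{u} A)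
      (_ : quotientFunctor.{u, u, u} R A ⊣ G)
      (M : Type u) [AddCommGroup M] [Module R M] [Module A M] [IsScalarTower R A M],
      (Module.IsTorsion R M →
        Nonempty (G.obj ((quotientFunctor R A).obj (ModuleCat.of A M)) ≃ₗ[A]
          ⨁ P : HeightOnePrime R, LocalizationAtPrime P.1 M)) ∧
      (Module.IsTorsionFree R M →
        (∀ N ∈ minimalPrimes R, ∃ P : HeightOnePrime R, N ≤ P.1.asIdeal) →
        Nonempty (G.obj ((quotientFunctor R A).obj (ModuleCat.of A M)) ≃ₗ[A]
          divisorialHull R A M)) := by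
  have hR := hA.isPseudoNoetherian_base
  have := hA.isReduced_base
  refine ⟨?_, fun G adj M _ _ _ _ => ⟨fun hM => ?_, fun hM hmin => ?_⟩⟩
  · refine MorphismProperty.isLeftAdjoint_of_exists_isLocal _
      (codimTwoModules R A).isoModSerre fun M => ?_
    let _ : Module R M := Module.compHom M (algebraMap R A)
    have : IsScalarTower R A M := .of_algebraMap_smul fun _ _ => rfl
    exact ⟨_, _, isoModSerre_codRestrict_codimTwoSaturation (toPiLocalizationAtPrime R A M)
      exists_smul_eq_zero_of_toPiLocalizationAtPrime_eq_zero,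
      isCodimTwoClosed_pi_localizationAtPrime.codimTwoSaturation _⟩
  · obtain ⟨e⟩ := nonempty_rightAdjoint_obj_linearEquiv_codimTwoSaturation adj
      isCodimTwoClosed_pi_localizationAtPrime (toPiLocalizationAtPrime R A M)
      exists_smul_eq_zero_of_toPiLocalizationAtPrime_eq_zero
    rw [codimTwoSaturation_range_toPiLocalizationAtPrime hR hM] at e
    exact ⟨e.trans (LinearEquiv.ofInjective (directSumToPi R A M) DFunLike.coe_injective).symm⟩
  · obtain ⟨e⟩ := nonempty_rightAdjoint_obj_linearEquiv_codimTwoSaturation adj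
      (isCodimTwoClosed_fractionModule
        (by simpa [minimalPrimes] using hR.finite_minimalPrimes 0) hmin)
      (tensorLocalizationMap A R⁰ M) fun x hx P => ⟨1, P.1.asIdeal.one_notMem, by
        rw [(tensorLocalizationMap_nonZeroDivisors_eq_zero_iff x).1 hx, smul_zero]⟩
    rw [codimTwoSaturation_range_fractionModule] at e
    exact ⟨e⟩

end
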